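/- \textbf{Setting.} Let $\mathcal{L}$ be the set of formulas of propositional logic, or the set of closed formulas of predicate logic without equality over a signature with infinitely many constants, built from $\bot,\neg,\wedge,\vee,\to,\leftrightarrow$ (and $\forall,\exists$), with $\top:=\neg\bot$. A \emph{defeasible rule} is an expression $\varphi\leadsto\psi$ with $\varphi\in\mathcal{L}$ and $\psi$ either in $\mathcal{L}$ or a negated rule $\mathbf{not}(\eta\leadsto\mu)$. A \emph{supporting element} $s$ is a premise $\sigma\in\mathcal{L}$, a test $\chi?$ with $\chi\in\mathcal{L}$, or a pair $(\mathcal{S}',\varphi\leadsto\psi)$ where $\mathcal{S}'$ is a set of supporting elements and $\varphi\leadsto\psi$ is a defeasible rule (finite nesting depth); it supports $\hat s=\sigma$, $\chi$, $\psi$ respectively. For a set $\mathcal{S}$ of supporting elements put $\hat{\mathcal{S}}=\{\hat s\mid s\in\mathcal{S}\}$. An \emph{argument} is a pair $(\mathcal{S},\psi)$, with $\psi\in\mathcal{L}$ or $\psi$ a negated rule. A set of such claims is \emph{inconsistent} if no interpretation satisfies all its members that lie in $\mathcal{L}$, and \emph{minimal inconsistent} if moreover no proper subset is inconsistent. A \emph{tableau}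 is a finite tree of nodes, each a set of arguments, in which every non-leaf node $\Gamma$ is rewritten by a tableau rule applied to arguments in $\Gamma$; each child consists of $\Gamma$ and the arguments of one alternative (alternatives are separated by $\mid$). The rules are: \[ \begin{array}{ll} (\mathcal{S},\varphi\wedge\psi)\ \Rightarrow\ (\mathcal{S},\varphi),(\mathcal{S},\psi) & (\mathcal{S},\varphi\vee\psi)\ \Rightarrow\ (\mathcal{S},\varphi)\mid(\mathcal{S},\psi)\\ (\mathcal{S},\varphi\to\psi)\ \Rightarrow\ (\mathcal{S},\neg\varphi)\mid(\mathcal{S},\psi) & (\mathcal{S},\varphi\leftrightarrow\psi)\ \Rightarrow\ (\mathcal{S},\varphi\to\psi),(\mathcal{S},\psi\to\varphi)\\ (\mathcal{S},\neg(\varphi\vee\psi))\ \Rightarrow\ (\mathcal{S},\neg\varphi),(\mathcal{S},\neg\psi) & (\mathcal{S},\neg(\varphi\wedge\psi))\ \Rightarrow\ (\mathcal{S},\neg\varphi)\mid(\mathcal{S},\neg\psi)\\ (\mathcal{S},\neg(\varphi\to\psi))\ \Rightarrow\ (\mathcal{S},\varphi),(\mathcal{S},\neg\psi) & (\mathcal{S},\neg(\varphi\leftrightarrow\psi))\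 \Rightarrow\ (\mathcal{S},\neg(\varphi\to\psi))\mid(\mathcal{S},\neg(\psi\to\varphi))\\ (\mathcal{S},\neg\neg\varphi)\ \Rightarrow\ (\mathcal{S},\varphi) & (\mathcal{S},\varphi),(\mathcal{S}',\neg\varphi)\ \Rightarrow\ (\mathcal{S}\cup\mathcal{S}',\bot) \end{array} \] and, for predicate logic, $(\mathcal{S},\forall x\,\varphi)\Rightarrow(\mathcal{S},\varphi[x/t])$, $(\mathcal{S},\neg\exists x\,\varphi)\Rightarrow(\mathcal{S},\neg\varphi[x/t])$, $(\mathcal{S},\exists x\,\varphi)\Rightarrow(\mathcal{S},\varphi[x/c])$, $(\mathcal{S},\neg\forall x\,\varphi)\Rightarrow(\mathcal{S},\neg\varphi[x/c])$, where $t$ is a ground term occurring in the claims of the current node (or any constant if no ground term occurs there) and $c$ is a constant not occurring in the claims of the current node. If $\Lambda_1,\dots,\Lambda_n$ are the leaves of a tableau and $(\mathcal{S}_i,\bot)\in\Lambda_i$ for every $i$, then $\bigcup_{i=1}^n\mathcal{S}_i$ is a \emph{support for the closure} of the tableau. A tableau $\mathcal{T}'$ \emph{extends} $\mathcal{T}$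 if it arises from $\mathcal{T}$ by expanding (zero or more) leaves of $\mathcal{T}$ further. \textbf{Proposition.} Let $\mathcal{T}$ be a tableau with root $\Gamma_0=\{(\mathcal{S}_i,\psi_i)\}_{i=1}^n$ such that each $(\mathcal{S}_i,\psi_i)$ is of the form $(\{s\},\hat s)$, that is, $(\{\sigma\},\sigma)$ or $(\{\chi?\},\chi)$ or $(\{(\mathcal{S}',\varphi\leadsto\psi)\},\psi)$. Let $\Psi=\{\psi\mid(\mathcal{S},\psi)\in\Gamma_0\}$. \begin{enumerate} \item If $\mathcal{S}$ is a support for the closure of $\mathcal{T}$, then $\hat{\mathcal{S}}\subseteq\Psi$ and $\hat{\mathcal{S}}$ is inconsistent. \item Let $\mathcal{S}\subseteq\bigcup_{i=1}^n\mathcal{S}_i$ be a set whose elements support pairwise different claims. If $\hat{\mathcal{S}}\subseteq\Psi$ is a minimal inconsistent set, then there is a tableau $\mathcal{T}'$ that extends $\mathcal{T}$ such that $\mathcal{S}$ is a support for the closure of $\mathcal{T}'$. \end{enumerate} -/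

import Mathlib

universe u v w

namespace ArgTab

/-! ### Claims, defeasible rules, supports and arguments over a set `F` of propositions -/

/-- What an argument can conclude: a proposition of the language, or a negated defeasible rule
`not (η ⇝ μ)`. -/
inductive Claim (F : Type u) : Type u
  | fml (φ : F) : Claim F
  | notRule (η : F) (μ : Claim F) : Claim F

/-- Some proposition inside the claim satisfies `p`. -/
def Claim.Any {F : Type u} (p : F → Prop) : Claim F → Prop
  | .fml φ => p φ
  | .notRule η μ => p η ∨ μ.Any p

/-- A defeasible rule `ante ⇝ cons`. -/
structure DRule (F : Type u) : Type u where
  ante : F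
  cons : Claim F

/-- A supporting element: a premise `σ`, a test `χ?`, or `(S', φ ⇝ ψ)` where `S'` is a set of
supporting elements taken from `A`. -/
inductive SuppElem (F A : Type u) : Type u
  | premise (σ : F) : SuppElem F A
  | test (χ : F) : SuppElem F A
  | rule (S' : Set A) (r : DRule F) : SuppElem F A

/-- Supporting elements in which rule elements are nested to depth less than `n`. Every
supporting element of finite depth has exactly one representative at each sufficiently large
level, and two of them are equal iff the sets nested in them are. -/
def SuppLevel (F : Type u) : ℕ → Type u
  | 0 => PEmpty
  | n + 1 => SuppElem F (SuppLevel F n)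

section
variable {F A : Type u}

/-- The claim supported directly by a supporting element. -/
def SuppElem.hat : SuppElem F A → Claim F
  | .premise σ => .fml σ
  | .test χ => .fml χ
  | .rule _ r => r.cons

/-- The supporting propositions `Ŝ` of a support `S`. -/
def hatSet (S : Set (SuppElem F A)) : Set (Claim F) := SuppElem.hat '' S

/-- A couple `(S, ψ)`. -/
abbrev Argument (F A : Type u) : Type u := Set (SuppElem F A) × Claim F

/-- A tableau node is a set of arguments. -/
abbrev Node (F A : Type u) : Type u := Set (Argument F A)

/-- The arguments with which a tableau starts: `({σ}, σ)` for a premise, `({χ?}, χ)` for a test,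
and `({(S', φ ⇝ ψ)}, ψ)` for a supported defeasible rule. -/
def IsRootArgument (a : Argument F A) : Prop := ∃ s : SuppElem F A, a = ({s}, s.hat)

/-- `Ψ = {ψ | (S, ψ) ∈ Γ}`. -/
def conclusions (Γ : Node F A) : Set (Claim F) := {ψ | ∃ S, (S, ψ) ∈ Γ}

/-- The elements that occur in the supports of the arguments of a node. -/
def elements (Γ : Node F A) : Set (SuppElem F A) := {s | ∃ S ψ, (S, ψ) ∈ Γ ∧ s ∈ S}

/-! ### Tableaux -/

/-- Finite tableaux with root `Γ`, for a set `R` of tableau rules: `R Γ Δs` says that a rule can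
rewrite the node `Γ` and that its alternatives are the members of the list `Δs`. A child holds
all arguments of its parent and those of one alternative. -/
inductive Tableau (R : Node F A → List (Node F A) → Prop) : Node F A → Type u
  | leaf (Γ : Node F A) : Tableau R Γ
  | expand (Γ : Node F A) (Δs : List (Node F A)) (h : R Γ Δs)
      (child : ∀ i : Fin Δs.length, Tableau R (Γ ∪ Δs.get i)) : Tableau R Γ

variable {R : Node F A → List (Node F A) → Prop}

/-- The leaf nodes, from left to right, with repetitions. -/
def Tableau.leaves : {Γ : Node F A} → Tableau R Γ → List (Node F A)
  | _, .leaf Γ => [Γ]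
  | _, .expand _ _ _ child => (List.ofFn fun i => (child i).leaves).flatten

/-- `T.Extends T'`: the tableau `T'` arises from `T` by expanding leaves of `T` further. -/
inductive Tableau.Extends : {Γ : Node F A} → Tableau R Γ → Tableau R Γ → Prop
  | leaf (Γ : Node F A) (T' : Tableau R Γ) : Tableau.Extends (.leaf Γ) T'
  | expand (Γ : Node F A) (Δs : List (Node F A)) (h : R Γ Δs)
      (child child' : ∀ i : Fin Δs.length, Tableau R (Γ ∪ Δs.get i))
      (hc : ∀ i, Tableau.Extends (child i) (child' i)) :
      Tableau.Extends (.expand Γ Δs h child) (.expand Γ Δs h child')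

end

/-! ### The propositional tableau rules -/

/-- Notation for the connectives that the two languages below share. -/
class Connectives (F : Type u) where
  bot : F
  neg : F → F
  and : F → F → F
  or : F → F → F
  imp : F → F → F
  iff : F → F → F

open Connectives

section
variable {F A : Type u} [Connectives F]

/-- `⊤` is the abbreviation of `¬⊥`. -/
def top : F := neg bot

/-- The tableau is closed and `S` is a support for its closure: for every leaf `Λᵢ` an argument
`(Sᵢ, ⊥) ∈ Λᵢ` is chosen, and `S` is the union of the `Sᵢ`. -/
def Tableau.IsClosureSupport {R : Node F A → List (Node F A) → Prop} {Γ : Node F A}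
    (T : Tableau R Γ) (S : Set (SuppElem F A)) : Prop :=
  ∃ f : Fin T.leaves.length → Set (SuppElem F A),
    (∀ i, (f i, Claim.fml bot) ∈ T.leaves.get i) ∧ S = ⋃ i, f i

inductive PropRule : Node F A → List (Node F A) → Prop
  | and {Γ S φ ψ} : (S, .fml (and φ ψ)) ∈ Γ → PropRule Γ [{(S, .fml φ), (S, .fml ψ)}]
  | or {Γ S φ ψ} : (S, .fml (or φ ψ)) ∈ Γ → PropRule Γ [{(S, .fml φ)}, {(S, .fml ψ)}]
  | imp {Γ S φ ψ} : (S, .fml (imp φ ψ)) ∈ Γ →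
      PropRule Γ [{(S, .fml (neg φ))}, {(S, .fml ψ)}]
  | iff {Γ S φ ψ} : (S, .fml (iff φ ψ)) ∈ Γ →
      PropRule Γ [{(S, .fml (imp φ ψ)), (S, .fml (imp ψ φ))}]
  | negOr {Γ S φ ψ} : (S, .fml (neg (or φ ψ))) ∈ Γ →
      PropRule Γ [{(S, .fml (neg φ)), (S, .fml (neg ψ))}]
  | negAnd {Γ S φ ψ} : (S, .fml (neg (and φ ψ))) ∈ Γ →
      PropRule Γ [{(S, .fml (neg φ))}, {(S, .fml (neg ψ))}]
  | negImp {Γ S φ ψ} : (S, .fml (neg (imp φ ψ))) ∈ Γ →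
      PropRule Γ [{(S, .fml φ), (S, .fml (neg ψ))}]
  | negIff {Γ S φ ψ} : (S, .fml (neg (iff φ ψ))) ∈ Γ →
      PropRule Γ [{(S, .fml (neg (imp φ ψ)))}, {(S, .fml (neg (imp ψ φ)))}]
  | negNeg {Γ S φ} : (S, .fml (neg (neg φ))) ∈ Γ → PropRule Γ [{(S, .fml φ)}]
  | close {Γ S S' φ} : (S, .fml φ) ∈ Γ → (S', .fml (neg φ)) ∈ Γ →
      PropRule Γ [{(S ∪ S', .fml bot)}]

end

/-! ### Propositional logic -/

/-- Propositions over a set `P` of atoms. -/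
inductive PForm (P : Type u) : Type u
  | atom (p : P)
  | bot
  | neg (φ : PForm P)
  | and (φ ψ : PForm P)
  | or (φ ψ : PForm P)
  | imp (φ ψ : PForm P)
  | iff (φ ψ : PForm P)

instance (P : Type u) : Connectives (PForm P) := ⟨.bot, .neg, .and, .or, .imp, .iff⟩

def PForm.Holds {P : Type u} (I : P → Prop) : PForm P → Prop
  | .atom p => I p
  | .bot => False
  | .neg φ => ¬ φ.Holds I
  | .and φ ψ => φ.Holds I ∧ ψ.Holds I
  | .or φ ψ => φ.Holds I ∨ ψ.Holds I
  | .imp φ ψ => φ.Holds I → ψ.Holds I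
  | .iff φ ψ => (φ.Holds I ↔ ψ.Holds I)

/-- No truth assignment satisfies all propositions in `X`. (Negated rules in `X` are not
propositions of the language.) -/
def PropInconsistent {P : Type u} (X : Set (Claim (PForm P))) : Prop :=
  ¬ ∃ I : P → Prop, ∀ φ, Claim.fml φ ∈ X → φ.Holds I

/-! ### Predicate logic -/



/-- Formulas of predicate logic without equality over the signature `L`, with free variables
among `0, …, n - 1`. The quantifiers bind variable `n` of their scope. -/
inductive Form (L : FirstOrder.Language.{u, v}) : ℕ → Type (max u v)
  | rel {n l : ℕ} (Q : L.Relations l) (ts : Fin l → L.Term (Fin n)) : Form L n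
  | bot {n : ℕ} : Form L n
  | neg {n : ℕ} (φ : Form L n) : Form L n
  | and {n : ℕ} (φ ψ : Form L n) : Form L n
  | or {n : ℕ} (φ ψ : Form L n) : Form L n
  | imp {n : ℕ} (φ ψ : Form L n) : Form L n
  | iff {n : ℕ} (φ ψ : Form L n) : Form L n
  | all {n : ℕ} (φ : Form L (n + 1)) : Form L n
  | ex {n : ℕ} (φ : Form L (n + 1)) : Form L n

instance (L : FirstOrder.Language.{u, v}) (n : ℕ) : Connectives (Form L n) :=
  ⟨.bot, .neg, .and, .or, .imp, .iff⟩

/-- The propositions of predicate logic are the closed formulas. -/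
abbrev Sent (L : FirstOrder.Language.{u, v}) : Type (max u v) := Form L 0

abbrev GroundTerm (L : FirstOrder.Language.{u, v}) : Type u := L.Term (Fin 0)

section
variable {L : FirstOrder.Language.{u, v}}

def Form.Holds {M : Type w} [L.Structure M] : {n : ℕ} → Form L n → (Fin n → M) → Prop
  | _, .rel Q ts, x => FirstOrder.Language.Structure.RelMap Q fun i => (ts i).realize x
  | _, .bot, _ => False
  | _, .neg φ, x => ¬ φ.Holds x
  | _, .and φ ψ, x => φ.Holds x ∧ ψ.Holds x
  | _, .or φ ψ, x => φ.Holds x ∨ ψ.Holds x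
  | _, .imp φ ψ, x => φ.Holds x → ψ.Holds x
  | _, .iff φ ψ, x => (φ.Holds x ↔ ψ.Holds x)
  | _, .all φ, x => ∀ a : M, φ.Holds (Fin.snoc x a)
  | _, .ex φ, x => ∃ a : M, φ.Holds (Fin.snoc x a)

/-- No interpretation (with non-empty domain) satisfies all propositions in `X`. -/
def PredInconsistent (X : Set (Claim (Sent L))) : Prop :=
  ¬ ∃ (M : Type (max u v)) (_ : Nonempty M) (_ : L.Structure M),
    ∀ φ : Sent L, Claim.fml φ ∈ X → φ.Holds (Fin.elim0 : Fin 0 → M)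

/-- Simultaneous substitution of terms for the free variables. -/
def Form.subst : {n m : ℕ} → Form L n → (Fin n → L.Term (Fin m)) → Form L m
  | _, _, .rel Q ts, σ => .rel Q fun i => (ts i).subst σ
  | _, _, .bot, _ => .bot
  | _, _, .neg φ, σ => .neg (φ.subst σ)
  | _, _, .and φ ψ, σ => .and (φ.subst σ) (ψ.subst σ)
  | _, _, .or φ ψ, σ => .or (φ.subst σ) (ψ.subst σ)
  | _, _, .imp φ ψ, σ => .imp (φ.subst σ) (ψ.subst σ)
  | _, _, .iff φ ψ, σ => .iff (φ.subst σ) (ψ.subst σ)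
  | _, m, .all φ, σ => .all (φ.subst
      (Fin.snoc (α := fun _ => L.Term (Fin (m + 1)))
        (fun i => (σ i).relabel Fin.castSucc) (.var (Fin.last m))))
  | _, m, .ex φ, σ => .ex (φ.subst
      (Fin.snoc (α := fun _ => L.Term (Fin (m + 1)))
        (fun i => (σ i).relabel Fin.castSucc) (.var (Fin.last m))))

/-- `φ[x/t]` for a formula whose only free variable is `x`. -/
def Form.inst (φ : Form L 1) (t : GroundTerm L) : Sent L := φ.subst fun _ => t

/-- `IsSubterm s t`: the term `s` occurs in the term `t`. -/
inductive IsSubterm {α : Type} (s : L.Term α) : L.Term α → Prop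
  | refl : IsSubterm s s
  | func {l : ℕ} (f : L.Functions l) (ts : Fin l → L.Term α) (i : Fin l) :
      IsSubterm s (ts i) → IsSubterm s (.func f ts)

/-- The ground term `t` occurs in the formula. -/
def Form.Mentions (t : GroundTerm L) : {n : ℕ} → Form L n → Prop
  | _, .rel _ ts => ∃ i, IsSubterm (t.relabel Fin.elim0) (ts i)
  | _, .bot => False
  | _, .neg φ => φ.Mentions t
  | _, .and φ ψ => φ.Mentions t ∨ ψ.Mentions t
  | _, .or φ ψ => φ.Mentions t ∨ ψ.Mentions t
  | _, .imp φ ψ => φ.Mentions t ∨ ψ.Mentions t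
  | _, .iff φ ψ => φ.Mentions t ∨ ψ.Mentions t
  | _, .all φ => φ.Mentions t
  | _, .ex φ => φ.Mentions t

variable {A : Type (max u v)}

/-- The ground term `t` occurs in the claim of an argument of `Γ`. -/
def OccursIn (t : GroundTerm L) (Γ : Node (Sent L) A) : Prop :=
  ∃ ψ ∈ conclusions Γ, ψ.Any (Form.Mentions t)

/-- Terms that may instantiate a universal claim at `Γ`: those occurring in `Γ` and, if no ground
term occurs in `Γ`, the constants. -/
def Usable (t : GroundTerm L) (Γ : Node (Sent L) A) : Prop :=
  OccursIn t Γ ∨ ((∀ t' : GroundTerm L, ¬ OccursIn t' Γ) ∧ ∃ c : L.Constants, t = c.term)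

inductive PredRule : Node (Sent L) A → List (Node (Sent L) A) → Prop
  | prop {Γ Δs} : PropRule Γ Δs → PredRule Γ Δs
  | all {Γ S} {φ : Form L 1} {t : GroundTerm L} : (S, .fml (.all φ)) ∈ Γ → Usable t Γ →
      PredRule Γ [{(S, .fml (φ.inst t))}]
  | ex {Γ S} {φ : Form L 1} {c : L.Constants} : (S, .fml (.ex φ)) ∈ Γ →
      ¬ OccursIn c.term Γ → PredRule Γ [{(S, .fml (φ.inst c.term))}]
  | negAll {Γ S} {φ : Form L 1} {c : L.Constants} : (S, .fml (.neg (.all φ))) ∈ Γ →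
      ¬ OccursIn c.term Γ → PredRule Γ [{(S, .fml (.neg (φ.inst c.term)))}]
  | negEx {Γ S} {φ : Form L 1} {t : GroundTerm L} : (S, .fml (.neg (.ex φ))) ∈ Γ →
      Usable t Γ → PredRule Γ [{(S, .fml (.neg (φ.inst t)))}]

end

end ArgTab

open ArgTab

/-!
Both parts are soundness and completeness of tableaux, relativized to a set `S` of supporting
elements: only the arguments of a node whose support is contained in `S` count
(`claimsWithin S Γ`).

Soundness: if the propositions in `Ŝ` have a model, then so do the conclusions within `S` at the
root, and each rule passes this on to one of its children (`PropRule.sound`, `PredRule.sound`). The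
reached leaf does not contain `⊥` with a support inside `S`, so `S` is not a support for the
closure. That `Ŝ` consists of conclusions of the root holds since the rules invent no supporting
elements.

Completeness: let `Γ` be a finite node that contains `({s}, ŝ)` for all `s ∈ S`, and suppose that
no tableau with root `Γ` is closed with supports inside `S`. This property is inherited by some
child under each rule, so there is an increasing chain of such nodes, each of which carries out all the
finitely many rule applications that its predecessor calls for (`Forceable`, `exists_chain`). What
the limit concludes within `S` is a Hintikka set (`isHintikka_of_chain`), which has a model; in the
case of predicate logic its domain consists of the ground terms that occur in the limit
(`IsOpenNode.exists_model`), which is why instantiation with occurring terms is enough. Hence if `Ŝ`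
is inconsistent, every leaf of a given tableau can be expanded to a closed tableau with supports
inside `S`.

The resulting support `S₀ ⊆ S` for the closure is inconsistent by soundness, so `Ŝ₀ = Ŝ` by
minimality, and `S₀ = S` since the elements of `S` support different claims
(`closureSupport_characterization`).
-/

namespace ArgTab

open Connectives

/-! ### Leaves and extensions of tableaux -/

section
variable {F A : Type u} {R : Node F A → List (Node F A) → Prop} {Γ : Node F A}

theorem Tableau.mem_leaves_expand {Δs : List (Node F A)} {h : R Γ Δs}
    {child : ∀ i : Fin Δs.length, Tableau R (Γ ∪ Δs.get i)} {Λ : Node F A} :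
    Λ ∈ (Tableau.expand Γ Δs h child).leaves ↔ ∃ i, Λ ∈ (child i).leaves := by
  simp only [Tableau.leaves, List.mem_flatten, List.mem_ofFn]
  constructor
  · rintro ⟨_, ⟨i, rfl⟩, hi⟩
    exact ⟨i, hi⟩
  · rintro ⟨i, hi⟩
    exact ⟨_, ⟨i, rfl⟩, hi⟩

theorem Tableau.exists_leaf {p : Node F A → Prop}
    (hp : ∀ Γ Δs, R Γ Δs → p Γ → ∃ Δ ∈ Δs, p (Γ ∪ Δ)) (T : Tableau R Γ) (h : p Γ) :
    ∃ Λ ∈ T.leaves, p Λ := by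
  induction T with
  | leaf Γ => exact ⟨Γ, by simp [Tableau.leaves], h⟩
  | expand Γ Δs hR child ih =>
    obtain ⟨Δ, hΔ, hpΔ⟩ := hp Γ Δs hR h
    obtain ⟨i, rfl⟩ := List.get_of_mem hΔ
    obtain ⟨Λ, hΛ, hpΛ⟩ := ih i hpΔ
    exact ⟨Λ, Tableau.mem_leaves_expand.2 ⟨i, hΛ⟩, hpΛ⟩

theorem Tableau.forall_leaves {p : Node F A → Prop}
    (hp : ∀ Γ Δs, R Γ Δs → p Γ → ∀ Δ ∈ Δs, p (Γ ∪ Δ)) (T : Tableau R Γ) (h : p Γ) :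
    ∀ Λ ∈ T.leaves, p Λ := by
  induction T with
  | leaf Γ => simpa [Tableau.leaves] using h
  | expand Γ Δs hR child ih =>
    intro Λ hΛ
    obtain ⟨i, hi⟩ := Tableau.mem_leaves_expand.1 hΛ
    exact ih i (hp Γ Δs hR h _ (List.get_mem _ _)) Λ hi

theorem elements_union (Γ Δ : Node F A) : elements (Γ ∪ Δ) = elements Γ ∪ elements Δ := by
  ext s
  simp only [elements, Set.mem_ofPred_eq, Set.mem_union]
  grind

theorem mem_of_mem_elements (hΓ : ∀ a ∈ Γ, IsRootArgument a) {s : SuppElem F A}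
    (hs : s ∈ elements Γ) : ({s}, s.hat) ∈ Γ := by
  obtain ⟨S', ψ, ha, hs⟩ := hs
  obtain ⟨s', h'⟩ := hΓ _ ha
  cases h'
  obtain rfl : s = s' := hs
  exact ha

variable [Connectives F] {S : Set (SuppElem F A)}

/-- Every leaf of the tableau contains `⊥` with a support inside `S`. -/
def Tableau.ClosedWithin (T : Tableau R Γ) (S : Set (SuppElem F A)) : Prop :=
  ∀ Λ ∈ T.leaves, ∃ S' ⊆ S, (S', Claim.fml bot) ∈ Λ

/-- Some tableau with root `Γ` is closed with supports inside `S`. -/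
def Closable (R : Node F A → List (Node F A) → Prop) (S : Set (SuppElem F A)) (Γ : Node F A) :
    Prop :=
  ∃ T : Tableau R Γ, T.ClosedWithin S

theorem Closable.of_mem {S' : Set (SuppElem F A)} (hS : S' ⊆ S) (h : (S', Claim.fml bot) ∈ Γ) :
    Closable R S Γ := by
  refine ⟨.leaf Γ, fun Λ hΛ => ?_⟩
  obtain rfl : Λ = Γ := by simpa [Tableau.leaves] using hΛ
  exact ⟨S', hS, h⟩

theorem Closable.of_rule {Δs : List (Node F A)} (hR : R Γ Δs)
    (h : ∀ Δ ∈ Δs, Closable R S (Γ ∪ Δ)) : Closable R S Γ := by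
  choose child hc using fun i : Fin Δs.length => h _ (List.get_mem Δs i)
  refine ⟨.expand Γ Δs hR child, fun Λ hΛ => ?_⟩
  obtain ⟨i, hi⟩ := Tableau.mem_leaves_expand.1 hΛ
  exact hc i Λ hi

theorem Tableau.exists_extends_closedWithin (T : Tableau R Γ)
    (h : ∀ Λ ∈ T.leaves, Closable R S Λ) :
    ∃ T' : Tableau R Γ, T.Extends T' ∧ T'.ClosedWithin S := by
  induction T with
  | leaf Γ =>
    obtain ⟨T', hT'⟩ := h Γ (by simp [Tableau.leaves])
    exact ⟨T', .leaf Γ T', hT'⟩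
  | expand Γ Δs hR child ih =>
    choose child' hext hcl using fun i =>
      ih i fun Λ hΛ => h Λ (Tableau.mem_leaves_expand.2 ⟨i, hΛ⟩)
    refine ⟨.expand Γ Δs hR child', .expand Γ Δs hR child child' hext, fun Λ hΛ => ?_⟩
    obtain ⟨i, hi⟩ := Tableau.mem_leaves_expand.1 hΛ
    exact hcl i Λ hi

theorem Tableau.ClosedWithin.exists_isClosureSupport {T : Tableau R Γ} (h : T.ClosedWithin S) :
    ∃ S₀ ⊆ S, T.IsClosureSupport S₀ := by
  choose f hfS hf using fun i : Fin T.leaves.length => h _ (List.get_mem T.leaves i)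
  exact ⟨⋃ i, f i, Set.iUnion_subset hfS, f, hf, rfl⟩

theorem Tableau.IsClosureSupport.closedWithin {T : Tableau R Γ} (h : T.IsClosureSupport S) :
    T.ClosedWithin S := by
  obtain ⟨f, hf, rfl⟩ := h
  intro Λ hΛ
  obtain ⟨i, rfl⟩ := List.get_of_mem hΛ
  exact ⟨f i, Set.subset_iUnion f i, hf i⟩

theorem Tableau.IsClosureSupport.subset_elements
    (hR : ∀ Γ Δs, R Γ Δs → ∀ Δ ∈ Δs, elements Δ ⊆ elements Γ) {T : Tableau R Γ}
    (h : T.IsClosureSupport S) : S ⊆ elements Γ := by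
  obtain ⟨f, hf, rfl⟩ := h
  refine Set.iUnion_subset fun i s hs => ?_
  refine T.forall_leaves (p := fun Λ => elements Λ ⊆ elements Γ) (fun Γ' Δs h' hp Δ hΔ => ?_)
    subset_rfl _ (List.get_mem T.leaves i) ⟨f i, _, hf i, hs⟩
  rw [elements_union]
  exact Set.union_subset hp ((hR Γ' Δs h' Δ hΔ).trans hp)

/-- Both parts of the characterization of closure supports, for any tableau rules that introduce
only finitely many arguments, do not invent supporting elements, and are sound and complete for
`Inc`. In the second part, completeness only yields a closure support inside `S`; soundness and
minimality show that it is all of `S`. -/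
theorem closureSupport_characterization {Inc : Set (Claim F) → Prop}
    (hfin : ∀ Γ Δs, R Γ Δs → ∀ Δ ∈ Δs, Δ.Finite)
    (helem : ∀ Γ Δs, R Γ Δs → ∀ Δ ∈ Δs, elements Δ ⊆ elements Γ)
    (sound : ∀ (Γ : Node F A) (T : Tableau R Γ) (S : Set (SuppElem F A)),
      (∀ a ∈ Γ, IsRootArgument a) → T.IsClosureSupport S → Inc (hatSet S))
    (complete : ∀ (Γ : Node F A) (S : Set (SuppElem F A)), Γ.Finite →
      (∀ s ∈ S, ({s}, s.hat) ∈ Γ) → Inc (hatSet S) → Closable R S Γ)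
    (Γ₀ : Node F A) (hΓ₀ : Γ₀.Finite) (hroot : ∀ a ∈ Γ₀, IsRootArgument a) (T : Tableau R Γ₀) :
    (∀ S, T.IsClosureSupport S → hatSet S ⊆ conclusions Γ₀ ∧ Inc (hatSet S)) ∧
    (∀ S ⊆ elements Γ₀, Set.InjOn SuppElem.hat S →
      hatSet S ⊆ conclusions Γ₀ → Minimal Inc (hatSet S) →
      ∃ T' : Tableau R Γ₀, T.Extends T' ∧ T'.IsClosureSupport S) := by
  constructor
  · intro S hS
    refine ⟨?_, sound Γ₀ T S hroot hS⟩
    rintro _ ⟨s, hs, rfl⟩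
    exact ⟨{s}, mem_of_mem_elements hroot (hS.subset_elements helem hs)⟩
  · intro S hSel hinj _ hmin
    have hleaves : ∀ Λ ∈ T.leaves, Λ.Finite ∧ Γ₀ ⊆ Λ :=
      T.forall_leaves (p := fun Λ => Λ.Finite ∧ Γ₀ ⊆ Λ)
        (fun Γ Δs h hp Δ hΔ =>
          ⟨hp.1.union (hfin Γ Δs h Δ hΔ), hp.2.trans Set.subset_union_left⟩)
        ⟨hΓ₀, subset_rfl⟩
    obtain ⟨T', hext, hcl⟩ := T.exists_extends_closedWithin (S := S) fun Λ hΛ =>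
      complete Λ S (hleaves Λ hΛ).1
        (fun s hs => (hleaves Λ hΛ).2 (mem_of_mem_elements hroot (hSel hs))) hmin.prop
    obtain ⟨S₀, hS₀, hT'⟩ := hcl.exists_isClosureSupport
    have hhat : hatSet S ⊆ hatSet S₀ :=
      hmin.le_of_le (sound Γ₀ T' S₀ hroot hT') (Set.image_mono hS₀)
    obtain rfl : S₀ = S := by
      refine hS₀.antisymm fun s hs => ?_
      obtain ⟨s', hs', he⟩ := hhat ⟨s, hs, rfl⟩
      rwa [← hinj (hS₀ hs') hs he]
    exact ⟨T', hext, hT'⟩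

/-! ### Soundness of the propositional rules -/

/-- A truth valuation of the propositions that respects the connectives. -/
structure IsValuation (v : F → Prop) : Prop where
  bot : ¬ v bot
  neg : ∀ φ, v (neg φ) ↔ ¬ v φ
  and : ∀ φ ψ, v (and φ ψ) ↔ v φ ∧ v ψ
  or : ∀ φ ψ, v (or φ ψ) ↔ v φ ∨ v ψ
  imp : ∀ φ ψ, v (imp φ ψ) ↔ (v φ → v ψ)
  iff : ∀ φ ψ, v (iff φ ψ) ↔ (v φ ↔ v ψ)

/-- The propositions concluded in `Γ` with a support inside `S`. -/
def claimsWithin (S : Set (SuppElem F A)) (Γ : Node F A) : Set F :=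
  {φ | ∃ S' ⊆ S, (S', Claim.fml φ) ∈ Γ}

/-- A valuation that satisfies what `Γ` concludes within `S` does the same for one alternative of
each propositional rule. Arguments with a support that sticks out of `S` impose nothing. -/
theorem PropRule.sound {v : F → Prop} (hv : IsValuation v) {Δs : List (Node F A)}
    (h : PropRule Γ Δs) (hΓ : ∀ φ ∈ claimsWithin S Γ, v φ) :
    ∃ Δ ∈ Δs, ∀ φ ∈ claimsWithin S (Γ ∪ Δ), v φ := by
  suffices H : ∃ Δ ∈ Δs, ∀ S' ⊆ S, ∀ φ, (S', Claim.fml φ) ∈ Δ → v φ by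
    obtain ⟨Δ, hΔ, H⟩ := H
    refine ⟨Δ, hΔ, ?_⟩
    rintro φ ⟨S', hS', h' | h'⟩
    · exact hΓ φ ⟨S', hS', h'⟩
    · exact H S' hS' φ h'
  have key : ∀ {S₁ χ}, (S₁, Claim.fml χ) ∈ Γ → S₁ ⊆ S → v χ := fun h₁ h₂ => hΓ _ ⟨_, h₂, h₁⟩
  cases h with
  | @and S₁ φ ψ h₁ | @or S₁ φ ψ h₁ | @imp S₁ φ ψ h₁ | @iff S₁ φ ψ h₁ | @negOr S₁ φ ψ h₁
  | @negAnd S₁ φ ψ h₁ | @negImp S₁ φ ψ h₁ | @negIff S₁ φ ψ h₁ | @negNeg S₁ φ h₁ =>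
    by_cases hS : S₁ ⊆ S
    · have := key h₁ hS
      simp only [hv.and, hv.or, hv.imp, hv.iff, hv.neg] at this
      simp only [List.mem_cons, List.not_mem_nil, or_false, exists_eq_or_imp, exists_eq_left,
        Set.mem_insert_iff, Set.mem_singleton_iff, Prod.mk.injEq, Claim.fml.injEq]
      grind [hv.and, hv.or, hv.imp, hv.iff, hv.neg]
    · refine ⟨_, List.mem_cons_self, ?_⟩
      grind
  | @close S₁ S₂ φ h₁ h₂ =>
    refine ⟨_, List.mem_cons_self, fun S' hS' χ hχ => ?_⟩
    obtain ⟨rfl, h⟩ := Prod.mk.inj (Set.mem_singleton_iff.1 hχ)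
    exact absurd (key h₁ (Set.subset_union_left.trans hS'))
      ((hv.neg φ).1 (key h₂ (Set.subset_union_right.trans hS')))

/-- If the rules preserve satisfiability by members of `V` of what is concluded within `S`, then
the propositions in a closure support `S` have no model in `V`. -/
theorem Tableau.IsClosureSupport.not_satisfiable {V : Set (F → Prop)}
    (hV : ∀ v ∈ V, IsValuation v)
    (hR : ∀ Γ Δs, R Γ Δs → (∃ v ∈ V, ∀ φ ∈ claimsWithin S Γ, v φ) →
      ∃ Δ ∈ Δs, ∃ v ∈ V, ∀ φ ∈ claimsWithin S (Γ ∪ Δ), v φ)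
    {T : Tableau R Γ} (hΓ : ∀ a ∈ Γ, IsRootArgument a) (h : T.IsClosureSupport S) :
    ¬ ∃ v ∈ V, ∀ φ, Claim.fml φ ∈ hatSet S → v φ := by
  rintro ⟨v, hv, hsat⟩
  obtain ⟨Λ, hΛ, v', hv', hsat'⟩ := T.exists_leaf hR ⟨v, hv, by
    rintro φ ⟨S', hS', ha⟩
    obtain ⟨s, hs⟩ := hΓ _ ha
    obtain ⟨rfl, hφ⟩ := Prod.mk.inj hs
    exact hsat φ ⟨s, hS' rfl, hφ.symm⟩⟩
  exact (hV v' hv').bot (hsat' _ (h.closedWithin Λ hΛ))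

theorem PropRule.finite {Δs : List (Node F A)} (h : PropRule Γ Δs) : ∀ Δ ∈ Δs, Δ.Finite := by
  cases h <;> simp

theorem PropRule.elements_subset {Δs : List (Node F A)} (h : PropRule Γ Δs) :
    ∀ Δ ∈ Δs, elements Δ ⊆ elements Γ := by
  cases h <;>
    simp only [List.mem_cons, List.not_mem_nil, or_false, forall_eq_or_imp, forall_eq,
      elements, Set.ofPred_subset_ofPred, Set.mem_insert_iff, Set.mem_singleton_iff,
      Prod.mk.injEq] <;>
    grind

/-! ### Saturation of open nodes -/

/-- `Expansion a Δs`: a propositional rule other than `close` rewrites the argument `a` into the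
alternatives `Δs`. Unlike `PropRule`, this does not refer to a node, so that an expansion called
for at one node can be carried out at any larger one. -/
inductive Expansion : Argument F A → List (Node F A) → Prop
  | and {S φ ψ} : Expansion (S, .fml (and φ ψ)) [{(S, .fml φ), (S, .fml ψ)}]
  | or {S φ ψ} : Expansion (S, .fml (or φ ψ)) [{(S, .fml φ)}, {(S, .fml ψ)}]
  | imp {S φ ψ} : Expansion (S, .fml (imp φ ψ)) [{(S, .fml (neg φ))}, {(S, .fml ψ)}]
  | iff {S φ ψ} : Expansion (S, .fml (iff φ ψ)) [{(S, .fml (imp φ ψ)), (S, .fml (imp ψ φ))}]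
  | negOr {S φ ψ} : Expansion (S, .fml (neg (or φ ψ)))
      [{(S, .fml (neg φ)), (S, .fml (neg ψ))}]
  | negAnd {S φ ψ} : Expansion (S, .fml (neg (and φ ψ)))
      [{(S, .fml (neg φ))}, {(S, .fml (neg ψ))}]
  | negImp {S φ ψ} : Expansion (S, .fml (neg (imp φ ψ))) [{(S, .fml φ), (S, .fml (neg ψ))}]
  | negIff {S φ ψ} : Expansion (S, .fml (neg (iff φ ψ)))
      [{(S, .fml (neg (imp φ ψ)))}, {(S, .fml (neg (imp ψ φ)))}]
  | negNeg {S φ} : Expansion (S, .fml (neg (neg φ))) [{(S, .fml φ)}]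

theorem Expansion.propRule {a : Argument F A} {Δs : List (Node F A)} (h : Expansion a Δs)
    (ha : a ∈ Γ) : PropRule Γ Δs := by
  cases h
  · exact .and ha
  · exact .or ha
  · exact .imp ha
  · exact .iff ha
  · exact .negOr ha
  · exact .negAnd ha
  · exact .negImp ha
  · exact .negIff ha
  · exact .negNeg ha

/-- A finite node from which no tableau is closed with supports inside `S`. -/
structure IsOpenNode (R : Node F A → List (Node F A) → Prop) (S : Set (SuppElem F A))
    (Γ : Node F A) : Prop where
  finite : Γ.Finite
  not_closable : ¬ Closable R S Γ

theorem IsOpenNode.exists_alternative (h : IsOpenNode R S Γ) {Δs : List (Node F A)}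
    (hR : R Γ Δs) (hfin : ∀ Δ ∈ Δs, Δ.Finite) : ∃ Δ ∈ Δs, IsOpenNode R S (Γ ∪ Δ) := by
  by_contra! H
  refine h.not_closable (.of_rule hR fun Δ hΔ => ?_)
  by_contra hc
  exact H Δ hΔ ⟨h.finite.union (hfin Δ hΔ), hc⟩

/-- The property `Q` of nodes is inherited by larger nodes, and each extension of `Γ` with the
property `C` has a further extension with the properties `C` and `Q`. -/
structure Forceable {α : Type*} (C : Set α → Prop) (Γ : Set α) (Q : Set α → Prop) : Prop where
  mono : ∀ ⦃Γ₁ Γ₂⦄, Γ₁ ⊆ Γ₂ → Q Γ₁ → Q Γ₂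
  force : ∀ Γ₁, Γ ⊆ Γ₁ → C Γ₁ → ∃ Γ₂, Γ₁ ⊆ Γ₂ ∧ C Γ₂ ∧ Q Γ₂

end

namespace Forceable
variable {α : Type*} {C : Set α → Prop} {Γ : Set α} {Q Q' : Set α → Prop}

theorem and (h : Forceable C Γ Q) (h' : Forceable C Γ Q') :
    Forceable C Γ fun Γ' => Q Γ' ∧ Q' Γ' := by
  refine ⟨fun Γ₁ Γ₂ hs hQ => ⟨h.mono hs hQ.1, h'.mono hs hQ.2⟩, fun Γ₁ hs hC => ?_⟩
  obtain ⟨Γ₂, hs₂, hC₂, hQ⟩ := h.force Γ₁ hs hC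
  obtain ⟨Γ₃, hs₃, hC₃, hQ'⟩ := h'.force Γ₂ (hs.trans hs₂) hC₂
  exact ⟨Γ₃, hs₂.trans hs₃, hC₃, h.mono hs₃ hQ, hQ'⟩

theorem forall_mem {ι : Type*} {s : Set ι} (hs : s.Finite) {Q : ι → Set α → Prop}
    (h : ∀ i ∈ s, Forceable C Γ (Q i)) : Forceable C Γ fun Γ' => ∀ i ∈ s, Q i Γ' := by
  induction s, hs using Set.Finite.induction_on with
  | empty => exact ⟨by simp, fun Γ₁ _ hC => ⟨Γ₁, subset_rfl, hC, by simp⟩⟩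
  | @insert i s _ _ ih =>
    simp only [Set.forall_mem_insert] at h ⊢
    exact h.1.and (ih h.2)

end Forceable

/-- An increasing sequence, obtained by iterating a step that takes nodes with the property `C` to larger ones. -/
theorem exists_chain {α : Type*} {C : Set α → Prop} {Q : Set α → Set α → Prop}
    (step : ∀ Γ, C Γ → ∃ Γ', Γ ⊆ Γ' ∧ C Γ' ∧ Q Γ Γ') {Γ : Set α} (hΓ : C Γ) :
    ∃ G : ℕ → Set α, G 0 = Γ ∧ Monotone G ∧ ∀ n, C (G n) ∧ Q (G n) (G (n + 1)) := by
  choose f hsub hC hQ using step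
  let g : ℕ → {Γ // C Γ} := Nat.rec ⟨Γ, hΓ⟩ fun _ x => ⟨f x.1 x.2, hC x.1 x.2⟩
  exact ⟨fun n => (g n).1, rfl, monotone_nat_of_le_succ fun n => hsub _ (g n).2,
    fun n => ⟨(g n).2, hQ _ (g n).2⟩⟩

section
variable {F A : Type u} [Connectives F] {R : Node F A → List (Node F A) → Prop} {Γ : Node F A}
  {S : Set (SuppElem F A)}

/-- If each argument has at most one propositional expansion, then an open node can be extended
so that all its propositional expansions have been carried out. -/
theorem forceable_expansions (hR : ∀ Γ Δs, PropRule Γ Δs → R Γ Δs)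
    (huniq : ∀ (a : Argument F A) Δs Δs', Expansion a Δs → Expansion a Δs' → Δs = Δs')
    (hΓ : Γ.Finite) :
    Forceable (IsOpenNode R S) Γ
      fun Γ' => ∀ a ∈ Γ, ∀ Δs, Expansion a Δs → ∃ Δ ∈ Δs, Δ ⊆ Γ' := by
  refine Forceable.forall_mem hΓ fun a ha => ⟨fun Γ₁ Γ₂ hs hQ Δs h => ?_, fun Γ₁ hs hC => ?_⟩
  · obtain ⟨Δ, hΔ, hsub⟩ := hQ Δs h
    exact ⟨Δ, hΔ, hsub.trans hs⟩
  · by_cases h : ∃ Δs, Expansion a Δs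
    · obtain ⟨Δs, h⟩ := h
      have hrule := h.propRule (hs ha)
      obtain ⟨Δ, hΔ, hC'⟩ := hC.exists_alternative (hR _ _ hrule) hrule.finite
      refine ⟨_, Set.subset_union_left, hC', fun Δs' h' => ?_⟩
      obtain rfl := huniq a Δs Δs' h h'
      exact ⟨Δ, hΔ, Set.subset_union_right⟩
    · exact ⟨Γ₁, subset_rfl, hC, fun Δs h' => absurd ⟨Δs, h'⟩ h⟩

/-- The propositional conditions on a Hintikka set. -/
structure IsHintikka (H : Set F) : Prop where
  bot_notMem : bot ∉ H
  neg_notMem : ∀ {φ : F}, φ ∈ H → neg φ ∉ H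
  of_and : ∀ {φ ψ : F}, and φ ψ ∈ H → φ ∈ H ∧ ψ ∈ H
  of_or : ∀ {φ ψ : F}, or φ ψ ∈ H → φ ∈ H ∨ ψ ∈ H
  of_imp : ∀ {φ ψ : F}, imp φ ψ ∈ H → neg φ ∈ H ∨ ψ ∈ H
  of_iff : ∀ {φ ψ : F}, iff φ ψ ∈ H → imp φ ψ ∈ H ∧ imp ψ φ ∈ H
  of_negOr : ∀ {φ ψ : F}, neg (or φ ψ) ∈ H → neg φ ∈ H ∧ neg ψ ∈ H
  of_negAnd : ∀ {φ ψ : F}, neg (and φ ψ) ∈ H → neg φ ∈ H ∨ neg ψ ∈ H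
  of_negImp : ∀ {φ ψ : F}, neg (imp φ ψ) ∈ H → φ ∈ H ∧ neg ψ ∈ H
  of_negIff : ∀ {φ ψ : F}, neg (iff φ ψ) ∈ H → neg (imp φ ψ) ∈ H ∨ neg (imp ψ φ) ∈ H
  of_negNeg : ∀ {φ : F}, neg (neg φ) ∈ H → φ ∈ H

/-- The valuation `v` makes `φ` true if `H` contains it, and false if `H` contains its negation. -/
def Agrees (H : Set F) (v : F → Prop) (φ : F) : Prop :=
  (φ ∈ H → v φ) ∧ (neg φ ∈ H → ¬ v φ)

namespace IsHintikka
variable {H : Set F} {v : F → Prop} {φ ψ : F}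

theorem agrees_bot (hH : IsHintikka H) (hv : IsValuation v) : Agrees H v bot :=
  ⟨fun h => (hH.bot_notMem h).elim, fun _ => hv.bot⟩

theorem agrees_neg (hH : IsHintikka H) (hv : IsValuation v) (h : Agrees H v φ) :
    Agrees H v (neg φ) :=
  ⟨fun hn => (hv.neg φ).2 (h.2 hn), fun hn hf => (hv.neg φ).1 hf (h.1 (hH.of_negNeg hn))⟩

theorem agrees_and (hH : IsHintikka H) (hv : IsValuation v) (h : Agrees H v φ)
    (h' : Agrees H v ψ) : Agrees H v (and φ ψ) := by
  have := @hH.of_and φ ψ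
  have := @hH.of_negAnd φ ψ
  simp only [Agrees, hv.and] at *
  tauto

theorem agrees_or (hH : IsHintikka H) (hv : IsValuation v) (h : Agrees H v φ)
    (h' : Agrees H v ψ) : Agrees H v (or φ ψ) := by
  have := @hH.of_or φ ψ
  have := @hH.of_negOr φ ψ
  simp only [Agrees, hv.or] at *
  tauto

theorem agrees_imp (hH : IsHintikka H) (hv : IsValuation v) (h : Agrees H v φ)
    (h' : Agrees H v ψ) : Agrees H v (imp φ ψ) := by
  have := @hH.of_imp φ ψ
  have := @hH.of_negImp φ ψ
  simp only [Agrees, hv.imp] at *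
  tauto

theorem agrees_iff (hH : IsHintikka H) (hv : IsValuation v) (h : Agrees H v φ)
    (h' : Agrees H v ψ) : Agrees H v (iff φ ψ) := by
  have h₁ := hH.agrees_imp hv h h'
  have h₂ := hH.agrees_imp hv h' h
  simp only [Agrees, hv.imp, hv.iff] at *
  refine ⟨fun hm => ⟨h₁.1 (hH.of_iff hm).1, h₂.1 (hH.of_iff hm).2⟩, fun hm hf => ?_⟩
  exact (hH.of_negIff hm).elim (h₁.2 · hf.1) (h₂.2 · hf.2)

end IsHintikka

/-- The limit of a chain of open nodes, each of which carries out the propositional expansions of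
its predecessor, concludes a Hintikka set within `S`. -/
theorem isHintikka_of_chain (hR : ∀ Γ Δs, PropRule Γ Δs → R Γ Δs) {G : ℕ → Node F A}
    (hG : Monotone G) (hopen : ∀ n, IsOpenNode R S (G n))
    (hexp : ∀ n, ∀ a ∈ G n, ∀ Δs, Expansion a Δs → ∃ Δ ∈ Δs, Δ ⊆ G (n + 1)) :
    IsHintikka (claimsWithin S (⋃ n, G n)) := by
  have key : ∀ {S' χ Δs}, S' ⊆ S → (S', Claim.fml χ) ∈ ⋃ n, G n →
      Expansion (S', Claim.fml χ) Δs →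
      ∃ Δ ∈ Δs, ∀ ψ, (S', Claim.fml ψ) ∈ Δ → ψ ∈ claimsWithin S (⋃ n, G n) := by
    intro S' χ Δs hS' ha h
    obtain ⟨n, hn⟩ := Set.mem_iUnion.1 ha
    obtain ⟨Δ, hΔ, hs⟩ := hexp n _ hn Δs h
    exact ⟨Δ, hΔ, fun ψ hψ => ⟨S', hS', Set.mem_iUnion.2 ⟨n + 1, hs hψ⟩⟩⟩
  constructor
  case bot_notMem =>
    rintro ⟨S', hS', h⟩
    obtain ⟨n, hn⟩ := Set.mem_iUnion.1 h
    exact (hopen n).not_closable (.of_mem hS' hn)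
  case neg_notMem =>
    rintro φ ⟨S₁, hS₁, h₁⟩ ⟨S₂, hS₂, h₂⟩
    obtain ⟨m, hm⟩ := Set.mem_iUnion.1 h₁
    obtain ⟨n, hn⟩ := Set.mem_iUnion.1 h₂
    refine (hopen (max m n)).not_closable (.of_rule (hR _ _
      (.close (hG (le_max_left m n) hm) (hG (le_max_right m n) hn))) fun Δ hΔ => ?_)
    obtain rfl := List.mem_singleton.1 hΔ
    exact .of_mem (Set.union_subset hS₁ hS₂) (Or.inr rfl)
  all_goals
    intros
    rename_i h
    obtain ⟨S', hS', h⟩ := h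
  case of_and => simpa using key hS' h .and
  case of_or => simpa using key hS' h .or
  case of_imp => simpa using key hS' h .imp
  case of_iff => simpa using key hS' h .iff
  case of_negOr => simpa using key hS' h .negOr
  case of_negAnd => simpa using key hS' h .negAnd
  case of_negImp => simpa using key hS' h .negImp
  case of_negIff => simpa using key hS' h .negIff
  case of_negNeg => simpa using key hS' h .negNeg

end

/-! ### Propositional logic -/

section
variable {P : Type u} {A : Type u}

theorem PForm.expansion_unique (a : Argument (PForm P) A) (Δs Δs' : List (Node (PForm P) A))
    (h : Expansion a Δs) (h' : Expansion a Δs') : Δs = Δs' := by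
  cases h <;> cases h' <;> rfl

theorem PForm.isValuation (I : P → Prop) : IsValuation (PForm.Holds I) := by
  constructor <;> intros <;> simp [PForm.Holds, Connectives.bot, Connectives.neg,
    Connectives.and, Connectives.or, Connectives.imp, Connectives.iff]

/-- A Hintikka set is satisfied by making true exactly the atoms that it contains. -/
theorem IsHintikka.agrees {H : Set (PForm P)} (hH : IsHintikka H) (φ : PForm P) :
    Agrees H (PForm.Holds fun p => .atom p ∈ H) φ := by
  have hv := PForm.isValuation fun p => PForm.atom p ∈ H
  induction φ with
  | atom p => exact ⟨id, fun h h' => hH.neg_notMem h' h⟩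
  | bot => exact hH.agrees_bot hv
  | neg φ ih => exact hH.agrees_neg hv ih
  | and φ ψ ih₁ ih₂ => exact hH.agrees_and hv ih₁ ih₂
  | or φ ψ ih₁ ih₂ => exact hH.agrees_or hv ih₁ ih₂
  | imp φ ψ ih₁ ih₂ => exact hH.agrees_imp hv ih₁ ih₂
  | iff φ ψ ih₁ ih₂ => exact hH.agrees_iff hv ih₁ ih₂

theorem propInconsistent_of_isClosureSupport {Γ : Node (PForm P) A}
    {S : Set (SuppElem (PForm P) A)} (hΓ : ∀ a ∈ Γ, IsRootArgument a) {T : Tableau PropRule Γ}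
    (h : T.IsClosureSupport S) : PropInconsistent (hatSet S) := by
  rintro ⟨I, hI⟩
  refine h.not_satisfiable (V := {PForm.Holds I}) ?_ ?_ hΓ ⟨_, rfl, hI⟩
  · rintro _ rfl
    exact PForm.isValuation I
  · rintro Γ Δs hR ⟨_, rfl, hsat⟩
    obtain ⟨Δ, hΔ, h'⟩ := hR.sound (PForm.isValuation I) hsat
    exact ⟨Δ, hΔ, _, rfl, h'⟩

theorem closable_of_propInconsistent {Γ : Node (PForm P) A} {S : Set (SuppElem (PForm P) A)}
    (hΓ : Γ.Finite) (hS : ∀ s ∈ S, ({s}, s.hat) ∈ Γ) (hinc : PropInconsistent (hatSet S)) :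
    Closable PropRule S Γ := by
  by_contra hcl
  obtain ⟨G, rfl, hG, hG'⟩ := exists_chain (C := IsOpenNode PropRule S)
    (fun Γ h => (forceable_expansions (fun _ _ => id) PForm.expansion_unique h.finite).force
      Γ subset_rfl h) ⟨hΓ, hcl⟩
  have hH := isHintikka_of_chain (fun _ _ => id) hG (fun n => (hG' n).1) fun n => (hG' n).2
  refine hinc ⟨_, fun φ hφ => (hH.agrees φ).1 ?_⟩
  obtain ⟨s, hs, he⟩ := hφ
  exact ⟨{s}, Set.singleton_subset_iff.2 hs, Set.mem_iUnion.2 ⟨0, he ▸ hS s hs⟩⟩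

end

/-! ### Semantics of predicate logic -/

section
open FirstOrder FirstOrder.Language
variable {L : FirstOrder.Language.{u, v}}

/-- The valuation of sentences given by the structure `s`. -/
def SentHolds {M : Type w} (s : L.Structure M) (φ : Sent L) : Prop :=
  letI := s
  φ.Holds (Fin.elim0 : Fin 0 → M)

theorem isValuation_sentHolds {M : Type w} (s : L.Structure M) :
    IsValuation (SentHolds s) := by
  constructor <;> intros <;> simp [SentHolds, Form.Holds, Connectives.bot, Connectives.neg,
    Connectives.and, Connectives.or, Connectives.imp, Connectives.iff]

theorem Form.holds_subst {M : Type w} [L.Structure M] {n : ℕ} (φ : Form L n) {m : ℕ}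
    (σ : Fin n → L.Term (Fin m)) (x : Fin m → M) :
    (φ.subst σ).Holds x ↔ φ.Holds fun i => (σ i).realize x := by
  have snoc_realize : ∀ {n m : ℕ} (σ : Fin n → L.Term (Fin m)) (x : Fin m → M) (a : M),
      (fun i => (Fin.snoc (α := fun _ => L.Term (Fin (m + 1)))
        (fun i => (σ i).relabel Fin.castSucc) (.var (Fin.last m)) i).realize
          (Fin.snoc x a : Fin (m + 1) → M)) =
        (Fin.snoc (fun i => (σ i).realize x) a : Fin (n + 1) → M) := by
    intro n m σ x a
    funext i
    refine Fin.lastCases ?_ (fun i => ?_) i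
    · simp
    · simp only [Fin.snoc_castSucc, Term.realize_relabel]
      congr 1
      funext j
      simp
  induction φ generalizing m with
  | rel Q ts => simp [Form.subst, Form.Holds, Term.realize_subst]
  | bot => rfl
  | neg φ ih => simp only [Form.subst, Form.Holds, ih]
  | and φ ψ ih₁ ih₂ | or φ ψ ih₁ ih₂ | imp φ ψ ih₁ ih₂ | iff φ ψ ih₁ ih₂ =>
    simp only [Form.subst, Form.Holds, ih₁, ih₂]
  | all φ ih | ex φ ih => simp only [Form.subst, Form.Holds, ih, snoc_realize]

theorem Form.holds_inst {M : Type w} [L.Structure M] (φ : Form L 1) (t : GroundTerm L)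
    (x : Fin 0 → M) : (φ.inst t).Holds x ↔ φ.Holds (Fin.snoc x (t.realize x) : Fin 1 → M) := by
  rw [Form.inst, Form.holds_subst]
  congr! 1

/-- The structure `s` with the constant `c` reinterpreted as `a`. -/
@[reducible]
noncomputable def updateConst {M : Type w} (s : L.Structure M) (c : L.Constants) (a : M) :
    L.Structure M where
  funMap {n} f x :=
    open Classical in
    if (⟨n, f⟩ : Σ n, L.Functions n) = ⟨0, c⟩ then a else s.funMap f x
  RelMap Q x := s.RelMap Q x

theorem relabel_constants_term {α β : Type} (c : L.Constants) (g : α → β) :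
    (c.term : L.Term α).relabel g = c.term := by
  simp only [Constants.term, Term.relabel]
  congr 1
  exact Subsingleton.elim _ _

theorem realize_updateConst_self {M : Type w} (s : L.Structure M) (c : L.Constants) (a : M)
    {α : Type} (x : α → M) :
    @Term.realize L M (updateConst s c a) α x c.term = a := by
  exact if_pos rfl

theorem realize_updateConst {M : Type w} (s : L.Structure M) (c : L.Constants) (a : M)
    {α : Type} (x : α → M) (t : L.Term α) (h : ¬ IsSubterm c.term t) :
    @Term.realize L M (updateConst s c a) α x t = @Term.realize L M s α x t := by
  induction t with
  | var => rfl
  | @func n f ts ih =>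
    have hts : ∀ i, @Term.realize L M (updateConst s c a) α x (ts i) =
        @Term.realize L M s α x (ts i) := fun i => ih i fun h' => h (.func f ts i h')
    have hne : (⟨n, f⟩ : Σ n, L.Functions n) ≠ ⟨0, c⟩ := by
      intro he
      cases he
      apply h
      obtain rfl : ts = default := Subsingleton.elim _ _
      exact .refl
    simp only [Term.realize, hts]
    exact if_neg hne

theorem Form.holds_updateConst {M : Type w} (s : L.Structure M) (c : L.Constants) (a : M)
    {n : ℕ} (φ : Form L n) (h : ¬ φ.Mentions c.term) (x : Fin n → M) :
    @Form.Holds L M (updateConst s c a) n φ x ↔ @Form.Holds L M s n φ x := by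
  induction φ with
  | rel Q ts =>
    simp only [Form.Mentions, relabel_constants_term, not_exists] at h
    simp only [Form.Holds, realize_updateConst s c a x _ (h _)]
    rfl
  | bot => rfl
  | neg φ ih => simp only [Form.Holds, ih h]
  | and φ ψ ih₁ ih₂ | or φ ψ ih₁ ih₂ | imp φ ψ ih₁ ih₂ | iff φ ψ ih₁ ih₂ =>
    simp only [Form.Mentions, not_or] at h
    simp only [Form.Holds, ih₁ h.1, ih₂ h.2]
  | all φ ih | ex φ ih => simp only [Form.Holds, ih h]

/-! ### Soundness of the quantifier rules -/

variable {A : Type max u v}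

theorem PredRule.finite {Γ : Node (Sent L) A} {Δs : List (Node (Sent L) A)}
    (h : PredRule Γ Δs) : ∀ Δ ∈ Δs, Δ.Finite := by
  cases h with
  | prop h => exact h.finite
  | _ => simp

theorem PredRule.elements_subset {Γ : Node (Sent L) A} {Δs : List (Node (Sent L) A)}
    (h : PredRule Γ Δs) : ∀ Δ ∈ Δs, elements Δ ⊆ elements Γ := by
  cases h with
  | prop h => exact h.elements_subset
  | _ =>
    simp only [List.mem_cons, List.not_mem_nil, or_false, forall_eq,
      elements, Set.ofPred_subset_ofPred, Set.mem_singleton_iff, Prod.mk.injEq]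
    grind

theorem forall_claimsWithin_union_singleton {F A : Type u} {S S₁ : Set (SuppElem F A)}
    {Γ : Node F A} {v : F → Prop} {χ : F} (hΓ : ∀ φ ∈ claimsWithin S Γ, v φ)
    (h : S₁ ⊆ S → v χ) : ∀ φ ∈ claimsWithin S (Γ ∪ {(S₁, Claim.fml χ)}), v φ := by
  rintro φ ⟨S', hS', h' | h'⟩
  · exact hΓ φ ⟨S', hS', h'⟩
  · obtain ⟨rfl, h'⟩ := Prod.mk.inj (Set.mem_singleton_iff.1 h')
    cases h'
    exact h hS'

/-- A constant that does not occur in `Γ` can be reinterpreted without affecting `Γ`. -/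
theorem sentHolds_updateConst {M : Type w} {s : L.Structure M} {S : Set (SuppElem (Sent L) A)}
    {Γ : Node (Sent L) A} {c : L.Constants} (hc : ¬ OccursIn c.term Γ)
    (hΓ : ∀ φ ∈ claimsWithin S Γ, SentHolds s φ) (a : M) :
    ∀ φ ∈ claimsWithin S Γ, SentHolds (updateConst s c a) φ := by
  intro φ hφ
  refine (Form.holds_updateConst s c a φ (fun hm => hc ?_) _).2 (hΓ φ hφ)
  obtain ⟨S', -, h⟩ := hφ
  exact ⟨_, ⟨S', h⟩, hm⟩

theorem holds_inst_updateConst {M : Type w} (s : L.Structure M) (φ : Form L 1) (c : L.Constants)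
    (hc : ¬ φ.Mentions c.term) (a : M) :
    SentHolds (updateConst s c a) (φ.inst c.term) ↔
      @Form.Holds L M s 1 φ (Fin.snoc Fin.elim0 a : Fin 1 → M) := by
  rw [SentHolds, @Form.holds_inst, realize_updateConst_self, Form.holds_updateConst s c a φ hc]

/-- Satisfiability, over a fixed domain, of what is concluded within `S` passes to one alternative
of each rule. For existential claims the fresh constant is reinterpreted as a witness. -/
theorem PredRule.sound {M : Type w} {S : Set (SuppElem (Sent L) A)} {Γ : Node (Sent L) A}
    {Δs : List (Node (Sent L) A)} (h : PredRule Γ Δs) (s : L.Structure M)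
    (hΓ : ∀ φ ∈ claimsWithin S Γ, SentHolds s φ) :
    ∃ Δ ∈ Δs, ∃ s' : L.Structure M, ∀ φ ∈ claimsWithin S (Γ ∪ Δ), SentHolds s' φ := by
  have key : ∀ {S₁ χ}, (S₁, Claim.fml χ) ∈ Γ → S₁ ⊆ S → SentHolds s χ :=
    fun h₁ h₂ => hΓ _ ⟨_, h₂, h₁⟩
  cases h with
  | prop h =>
    obtain ⟨Δ, hΔ, h'⟩ := h.sound (isValuation_sentHolds s) hΓ
    exact ⟨Δ, hΔ, s, h'⟩
  | all h₁ _ =>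
    refine ⟨_, List.mem_cons_self, s, forall_claimsWithin_union_singleton hΓ fun hS => ?_⟩
    exact (@Form.holds_inst L M s _ _ _).2 (key h₁ hS _)
  | negEx h₁ _ =>
    refine ⟨_, List.mem_cons_self, s, forall_claimsWithin_union_singleton hΓ fun hS => ?_⟩
    exact fun h' => key h₁ hS ⟨_, (@Form.holds_inst L M s _ _ _).1 h'⟩
  | @ex S₁ φ c h₁ hc =>
    refine ⟨_, List.mem_cons_self, ?_⟩
    have hφ : ¬ φ.Mentions c.term := fun hm => hc ⟨_, ⟨_, h₁⟩, hm⟩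
    by_cases hS : S₁ ⊆ S
    · obtain ⟨a, ha⟩ := key h₁ hS
      exact ⟨updateConst s c a, forall_claimsWithin_union_singleton
        (sentHolds_updateConst hc hΓ a) fun _ => (holds_inst_updateConst s φ c hφ a).2 ha⟩
    · exact ⟨s, forall_claimsWithin_union_singleton hΓ fun h => absurd h hS⟩
  | @negAll S₁ φ c h₁ hc =>
    refine ⟨_, List.mem_cons_self, ?_⟩
    have hφ : ¬ φ.Mentions c.term := fun hm => hc ⟨_, ⟨_, h₁⟩, hm⟩
    by_cases hS : S₁ ⊆ S
    · obtain ⟨a, ha⟩ := not_forall.1 (key h₁ hS)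
      exact ⟨updateConst s c a, forall_claimsWithin_union_singleton
        (sentHolds_updateConst hc hΓ a) fun _ h' =>
          ha ((holds_inst_updateConst s φ c hφ a).1 h')⟩
    · exact ⟨s, forall_claimsWithin_union_singleton hΓ fun h => absurd h hS⟩

theorem predInconsistent_of_isClosureSupport {Γ : Node (Sent L) A}
    {S : Set (SuppElem (Sent L) A)} (hΓ : ∀ a ∈ Γ, IsRootArgument a) {T : Tableau PredRule Γ}
    (h : T.IsClosureSupport S) : PredInconsistent (hatSet S) := by
  rintro ⟨M, _, s, hs⟩
  refine h.not_satisfiable (V := Set.range (SentHolds (M := M))) ?_ ?_ hΓ ⟨_, ⟨s, rfl⟩, hs⟩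
  · rintro _ ⟨s, rfl⟩
    exact isValuation_sentHolds s
  · rintro Γ Δs hR ⟨_, ⟨s, rfl⟩, hsat⟩
    obtain ⟨Δ, hΔ, s', h'⟩ := hR.sound s hsat
    exact ⟨Δ, hΔ, _, ⟨s', rfl⟩, h'⟩

/-! ### Terms occurring in a node -/

theorem finite_isSubterm {α : Type} (t : L.Term α) : {s | IsSubterm s t}.Finite := by
  induction t with
  | var a =>
    refine (Set.finite_singleton (Term.var a)).subset fun s hs => ?_
    cases hs
    rfl
  | func f ts ih =>
    refine ((Set.finite_iUnion ih).insert (Term.func f ts)).subset fun s hs => ?_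
    cases hs with
    | refl => exact Or.inl rfl
    | func _ _ i h => exact Or.inr (Set.mem_iUnion.2 ⟨i, h⟩)

theorem IsSubterm.trans {α : Type} {r s t : L.Term α} (h : IsSubterm r s) (h' : IsSubterm s t) :
    IsSubterm r t := by
  induction h' with
  | refl => exact h
  | func f ts i _ ih => exact .func f ts i ih

theorem IsSubterm.relabel {α β : Type} {s t : L.Term α} (h : IsSubterm s t) (g : α → β) :
    IsSubterm (s.relabel g) (t.relabel g) := by
  induction h with
  | refl => exact .refl
  | func f ts i _ ih => exact .func f _ i ih

theorem relabel_injective {α β : Type} {g : α → β} (hg : Function.Injective g) :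
    Function.Injective (Term.relabel g : L.Term α → L.Term β) := by
  intro s t h
  induction s generalizing t with
  | var a => cases t with
    | var b => exact congrArg _ (hg (Term.var.inj h))
    | func => cases h
  | func f ts ih => cases t with
    | var => cases h
    | func f' ts' =>
      rw [Term.relabel, Term.relabel] at h
      injection h with hl hf hts
      subst hl
      obtain rfl := eq_of_heq hf
      exact congrArg _ (funext fun i => ih i (congrFun (eq_of_heq hts) i))

theorem Form.finite_mentions {n : ℕ} (φ : Form L n) : {t | φ.Mentions t}.Finite := by
  induction φ with
  | @rel n l Q ts =>
    refine (Set.finite_iUnion fun i => (finite_isSubterm (ts i)).preimage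
      (relabel_injective (L := L) (g := (Fin.elim0 : Fin 0 → Fin n))
        fun i => i.elim0).injOn).subset ?_
    rintro t ⟨i, hi⟩
    exact Set.mem_iUnion.2 ⟨i, hi⟩
  | bot => exact Set.finite_empty
  | neg φ ih | all φ ih | ex φ ih => exact ih
  | and φ ψ ih₁ ih₂ | or φ ψ ih₁ ih₂ | imp φ ψ ih₁ ih₂ | iff φ ψ ih₁ ih₂ => exact ih₁.union ih₂

theorem Claim.finite_any_mentions (ψ : Claim (Sent L)) :
    {t | ψ.Any (Form.Mentions t)}.Finite := by
  induction ψ with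
  | fml φ => exact φ.finite_mentions
  | notRule η μ ih => exact η.finite_mentions.union ih

theorem finite_occursIn {Γ : Node (Sent L) A} (hΓ : Γ.Finite) : {t | OccursIn t Γ}.Finite := by
  refine (hΓ.biUnion fun a _ => a.2.finite_any_mentions).subset ?_
  rintro t ⟨ψ, ⟨S', h⟩, ht⟩
  exact Set.mem_biUnion h ht

theorem OccursIn.mono {Γ Γ' : Node (Sent L) A} (h : Γ ⊆ Γ') {t : GroundTerm L}
    (ht : OccursIn t Γ) : OccursIn t Γ' := by
  obtain ⟨ψ, ⟨S', hS'⟩, ht⟩ := ht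
  exact ⟨ψ, ⟨S', h hS'⟩, ht⟩

theorem Form.Mentions.of_isSubterm {s t : GroundTerm L} (h : IsSubterm s t) {n : ℕ}
    {φ : Form L n} (ht : φ.Mentions t) : φ.Mentions s := by
  induction φ with
  | rel Q ts =>
    obtain ⟨i, hi⟩ := ht
    exact ⟨i, (h.relabel _).trans hi⟩
  | bot => exact ht
  | neg φ ih | all φ ih | ex φ ih => exact ih ht
  | and φ ψ ih₁ ih₂ | or φ ψ ih₁ ih₂ | imp φ ψ ih₁ ih₂ | iff φ ψ ih₁ ih₂ => exact ht.imp ih₁ ih₂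

theorem OccursIn.of_isSubterm {s t : GroundTerm L} (h : IsSubterm s t) {Γ : Node (Sent L) A}
    (ht : OccursIn t Γ) : OccursIn s Γ := by
  obtain ⟨ψ, hψ, ht⟩ := ht
  refine ⟨ψ, hψ, ?_⟩
  clear hψ
  induction ψ with
  | fml φ => exact Form.Mentions.of_isSubterm h ht
  | notRule η μ ih => exact ht.imp (Form.Mentions.of_isSubterm h) ih

theorem exists_fresh_constant [Infinite L.Constants] {Γ : Node (Sent L) A} (hΓ : Γ.Finite) :
    ∃ c : L.Constants, ¬ OccursIn c.term Γ := by
  have hinj : Function.Injective (fun c : L.Constants => (c.term : GroundTerm L)) := by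
    intro c c' h
    simpa [Constants.term] using h
  exact ((finite_occursIn hΓ).preimage hinj.injOn).exists_notMem

end

/-! ### Saturation for the quantifier rules -/

section
open FirstOrder FirstOrder.Language
variable {L : FirstOrder.Language.{u, v}} {A : Type max u v}

/-- `IsGamma χ f`: the sentence `χ` is universally quantified, possibly as a negated existential
quantification, and `f t` is its instance for the term `t`. -/
inductive IsGamma : Sent L → (GroundTerm L → Sent L) → Prop
  | all (φ : Form L 1) : IsGamma (.all φ) φ.inst
  | negEx (φ : Form L 1) : IsGamma (.neg (.ex φ)) fun t => .neg (φ.inst t)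

/-- `IsDelta χ f`: the sentence `χ` is existentially quantified, possibly as a negated universal
quantification, and `f t` is its instance for the term `t`. -/
inductive IsDelta : Sent L → (GroundTerm L → Sent L) → Prop
  | ex (φ : Form L 1) : IsDelta (.ex φ) φ.inst
  | negAll (φ : Form L 1) : IsDelta (.neg (.all φ)) fun t => .neg (φ.inst t)

theorem IsGamma.unique {χ : Sent L} {f f' : GroundTerm L → Sent L} (h : IsGamma χ f)
    (h' : IsGamma χ f') : f = f' := by
  cases h <;> cases h' <;> rfl

theorem IsDelta.unique {χ : Sent L} {f f' : GroundTerm L → Sent L} (h : IsDelta χ f)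
    (h' : IsDelta χ f') : f = f' := by
  cases h <;> cases h' <;> rfl

theorem IsGamma.predRule {χ : Sent L} {f : GroundTerm L → Sent L} (h : IsGamma χ f)
    {Γ : Node (Sent L) A} {S' : Set (SuppElem (Sent L) A)} (hχ : (S', .fml χ) ∈ Γ)
    {t : GroundTerm L} (ht : Usable t Γ) : PredRule Γ [{(S', .fml (f t))}] := by
  cases h
  · exact .all hχ ht
  · exact .negEx hχ ht

theorem IsDelta.predRule {χ : Sent L} {f : GroundTerm L → Sent L} (h : IsDelta χ f)
    {Γ : Node (Sent L) A} {S' : Set (SuppElem (Sent L) A)} (hχ : (S', .fml χ) ∈ Γ)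
    {c : L.Constants} (hc : ¬ OccursIn c.term Γ) : PredRule Γ [{(S', .fml (f c.term))}] := by
  cases h
  · exact .ex hχ hc
  · exact .negAll hχ hc

theorem Sent.expansion_unique (a : Argument (Sent L) A) (Δs Δs' : List (Node (Sent L) A))
    (h : Expansion a Δs) (h' : Expansion a Δs') : Δs = Δs' := by
  cases h <;> cases h' <;> rfl

variable {Γ : Node (Sent L) A} {S : Set (SuppElem (Sent L) A)}

theorem IsOpenNode.union_singleton (h : IsOpenNode PredRule S Γ) {a : Argument (Sent L) A}
    (hR : PredRule Γ [{a}]) : IsOpenNode PredRule S (Γ ∪ {a}) := by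
  obtain ⟨Δ, hΔ, h'⟩ := h.exists_alternative hR hR.finite
  obtain rfl := List.mem_singleton.1 hΔ
  exact h'

theorem forceable_delta [Infinite L.Constants] (hΓ : Γ.Finite) :
    Forceable (IsOpenNode PredRule S) Γ fun Γ' => ∀ a ∈ Γ, ∀ χ f, a.2 = .fml χ → IsDelta χ f →
      ∃ c : L.Constants, (a.1, Claim.fml (f c.term)) ∈ Γ' := by
  refine Forceable.forall_mem hΓ fun a ha => ⟨fun Γ₁ Γ₂ hs hQ χ f he hf => ?_, fun Γ₁ hs hC => ?_⟩
  · obtain ⟨c, hc⟩ := hQ χ f he hf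
    exact ⟨c, hs hc⟩
  · by_cases h : ∃ χ f, a.2 = .fml χ ∧ IsDelta χ f
    · obtain ⟨χ, f, he, hf⟩ := h
      obtain ⟨c, hc⟩ := exists_fresh_constant hC.finite
      have hχ : (a.1, Claim.fml χ) ∈ Γ₁ := he ▸ hs ha
      refine ⟨_, Set.subset_union_left, hC.union_singleton (hf.predRule hχ hc),
        fun χ' f' he' hf' => ⟨c, Or.inr ?_⟩⟩
      obtain rfl := Claim.fml.inj (he.symm.trans he')
      rw [hf.unique hf']
      rfl
    · exact ⟨Γ₁, subset_rfl, hC, fun χ f he hf => absurd ⟨χ, f, he, hf⟩ h⟩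

theorem forceable_gamma (hΓ : Γ.Finite) :
    Forceable (IsOpenNode PredRule S) Γ fun Γ' => ∀ a ∈ Γ, ∀ t ∈ {t | OccursIn t Γ}, ∀ χ f,
      a.2 = .fml χ → IsGamma χ f → (a.1, Claim.fml (f t)) ∈ Γ' := by
  refine Forceable.forall_mem hΓ fun a ha => Forceable.forall_mem (finite_occursIn hΓ) fun t ht =>
    ⟨fun Γ₁ Γ₂ hs hQ χ f he hf => hs (hQ χ f he hf), fun Γ₁ hs hC => ?_⟩
  by_cases h : ∃ χ f, a.2 = .fml χ ∧ IsGamma χ f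
  · obtain ⟨χ, f, he, hf⟩ := h
    have hχ : (a.1, Claim.fml χ) ∈ Γ₁ := he ▸ hs ha
    refine ⟨_, Set.subset_union_left,
      hC.union_singleton (hf.predRule hχ (.inl (OccursIn.mono hs ht))),
      fun χ' f' he' hf' => Or.inr ?_⟩
    obtain rfl := Claim.fml.inj (he.symm.trans he')
    rw [hf.unique hf']
    rfl
  · exact ⟨Γ₁, subset_rfl, hC, fun χ f he hf => absurd ⟨χ, f, he, hf⟩ h⟩

/-- As long as no ground term occurs, universal claims can be instantiated with the constant `c₀`.
Once a ground term occurs, this is no longer possible, but then it is not needed either. -/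
theorem forceable_gamma_constant (hΓ : Γ.Finite) (c₀ : L.Constants) :
    Forceable (IsOpenNode PredRule S) Γ fun Γ' => ∀ a ∈ Γ, ∀ χ f, a.2 = .fml χ → IsGamma χ f →
      (∃ t, OccursIn t Γ') ∨ (a.1, Claim.fml (f c₀.term)) ∈ Γ' := by
  refine Forceable.forall_mem hΓ fun a ha =>
    ⟨fun Γ₁ Γ₂ hs hQ χ f he hf => (hQ χ f he hf).imp (fun ⟨t, ht⟩ => ⟨t, ht.mono hs⟩) (hs ·),
      fun Γ₁ hs hC => ?_⟩
  by_cases ho : ∃ t, OccursIn t Γ₁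
  · exact ⟨Γ₁, subset_rfl, hC, fun _ _ _ _ => .inl ho⟩
  by_cases h : ∃ χ f, a.2 = .fml χ ∧ IsGamma χ f
  · obtain ⟨χ, f, he, hf⟩ := h
    have hχ : (a.1, Claim.fml χ) ∈ Γ₁ := he ▸ hs ha
    refine ⟨_, Set.subset_union_left,
      hC.union_singleton (hf.predRule hχ (.inr ⟨not_exists.1 ho, c₀, rfl⟩)),
      fun χ' f' he' hf' => Or.inr (Or.inr ?_)⟩
    obtain rfl := Claim.fml.inj (he.symm.trans he')
    rw [hf.unique hf']
    rfl
  · exact ⟨Γ₁, subset_rfl, hC, fun χ f he hf => absurd ⟨χ, f, he, hf⟩ h⟩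

/-! ### The model of a Hintikka set -/

/-- The number of connectives and quantifiers. -/
def Form.size : {n : ℕ} → Form L n → ℕ
  | _, .rel _ _ => 0
  | _, .bot => 0
  | _, .neg φ => φ.size + 1
  | _, .and φ ψ => φ.size + ψ.size + 1
  | _, .or φ ψ => φ.size + ψ.size + 1
  | _, .imp φ ψ => φ.size + ψ.size + 1
  | _, .iff φ ψ => φ.size + ψ.size + 1
  | _, .all φ => φ.size + 1
  | _, .ex φ => φ.size + 1

theorem Form.size_subst {n m : ℕ} (φ : Form L n) (σ : Fin n → L.Term (Fin m)) :
    (φ.subst σ).size = φ.size := by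
  induction φ generalizing m with
  | rel | bot => rfl
  | neg φ ih | all φ ih | ex φ ih => simp only [Form.subst, Form.size, ih]
  | and φ ψ ih₁ ih₂ | or φ ψ ih₁ ih₂ | imp φ ψ ih₁ ih₂ | iff φ ψ ih₁ ih₂ =>
    simp only [Form.subst, Form.size, ih₁, ih₂]

/-- A Hintikka set is satisfied in a structure whose elements are named by terms, through `val`,
in such a way that the terms mentioned in `H` denote themselves, the atoms that hold are those
in `H`, and `H` contains all named instances of its universal sentences. Terms other than names
may denote anything, so `val` need not be onto. -/
theorem IsHintikka.agrees_sent {M : Type w} (s : L.Structure M) {H : Set (Sent L)}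
    (hH : IsHintikka H) (val : M → GroundTerm L)
    (hreal : ∀ a : M, (val a).realize (Fin.elim0 : Fin 0 → M) = a)
    (hmen : ∀ φ ∈ H, ∀ t, φ.Mentions t → val (t.realize (Fin.elim0 : Fin 0 → M)) = t)
    (hrel : ∀ {l : ℕ} (Q : L.Relations l) (x : Fin l → M),
      Structure.RelMap Q x ↔ Form.rel Q (fun i => val (x i)) ∈ H)
    (hgamma : ∀ χ f, IsGamma χ f → χ ∈ H → ∀ a, f (val a) ∈ H)
    (hdelta : ∀ χ f, IsDelta χ f → χ ∈ H → ∃ t, f t ∈ H) (φ : Sent L) :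
    Agrees H (SentHolds s) φ := by
  have hv := isValuation_sentHolds s
  induction hk : φ.size using Nat.strong_induction_on generalizing φ with
  | _ k ih =>
  subst hk
  have ih' : ∀ (φ' : Sent L), φ'.size < φ.size → Agrees H (SentHolds s) φ' :=
    fun φ' h => ih _ h φ' rfl
  have inst_iff : ∀ (φ : Form L 1) (t : GroundTerm L), SentHolds s (φ.inst t) ↔
      φ.Holds (Fin.snoc Fin.elim0 (t.realize (Fin.elim0 : Fin 0 → M)) : Fin 1 → M) :=
    fun φ t => φ.holds_inst t _
  have inst_size : ∀ (φ : Form L 1) (t : GroundTerm L), (φ.inst t).size < φ.size + 1 :=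
    fun φ t => by rw [Form.inst, Form.size_subst]; exact Nat.lt_succ_self _
  match φ with
  | .rel Q ts =>
    have hts : ∀ χ ∈ H, (∀ i, χ.Mentions (ts i)) →
        (SentHolds s (.rel Q ts) ↔ Form.rel Q ts ∈ H) := by
      intro χ hχ hm
      simp only [SentHolds, Form.Holds, hrel, hmen χ hχ _ (hm _)]
    have hm : ∀ i, (Form.rel Q ts).Mentions (ts i) := by
      intro i
      refine ⟨i, ?_⟩
      rw [Subsingleton.elim (Fin.elim0 : Fin 0 → Fin 0) id, Term.relabel_id]
      exact .refl
    exact ⟨fun h => (hts _ h hm).2 h, fun h h' => hH.neg_notMem ((hts _ h hm).1 h') h⟩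
  | .bot => exact hH.agrees_bot hv
  | .neg φ => exact hH.agrees_neg hv (ih' φ (by grind [Form.size]))
  | .and φ ψ =>
    exact hH.agrees_and hv (ih' φ (by grind [Form.size])) (ih' ψ (by grind [Form.size]))
  | .or φ ψ =>
    exact hH.agrees_or hv (ih' φ (by grind [Form.size])) (ih' ψ (by grind [Form.size]))
  | .imp φ ψ =>
    exact hH.agrees_imp hv (ih' φ (by grind [Form.size])) (ih' ψ (by grind [Form.size]))
  | .iff φ ψ =>
    exact hH.agrees_iff hv (ih' φ (by grind [Form.size])) (ih' ψ (by grind [Form.size]))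
  | .all φ =>
    refine ⟨fun h a => ?_, fun h h' => ?_⟩
    · have := (inst_iff φ (val a)).1 ((ih' _ (inst_size φ _)).1 (hgamma _ _ (.all φ) h a))
      rwa [hreal] at this
    · obtain ⟨t, ht⟩ := hdelta _ _ (.negAll φ) h
      exact (ih' _ (inst_size φ t)).2 ht ((inst_iff φ t).2 (h' _))
  | .ex φ =>
    refine ⟨fun h => ?_, ?_⟩
    · obtain ⟨t, ht⟩ := hdelta _ _ (.ex φ) h
      exact ⟨_, (inst_iff φ t).1 ((ih' _ (inst_size φ t)).1 ht)⟩
    · rintro h ⟨a, ha⟩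
      refine (ih' _ (inst_size φ _)).2 (hgamma _ _ (.negEx φ) h a) ((inst_iff φ _).2 ?_)
      rwa [hreal]

/-- The structure on a set `U` of ground terms in which function symbols build terms, as far as
these are in `U`, with `t₀` as default value, and the atoms that hold are those in `H`. -/
@[reducible]
noncomputable def termStructure (U : Set (GroundTerm L)) (t₀ : U) (H : Set (Sent L)) :
    L.Structure (ULift.{v} U) where
  funMap f x :=
    open Classical in
    ULift.up (if h : Term.func f (fun i => (x i).down.1) ∈ U then ⟨_, h⟩ else t₀)
  RelMap Q x := Form.rel Q (fun i => (x i).down.1) ∈ H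

theorem realize_termStructure {U : Set (GroundTerm L)} {t₀ : U} {H : Set (Sent L)}
    (hU : ∀ t ∈ U, ∀ s, IsSubterm s t → s ∈ U) (x : Fin 0 → ULift.{v} U) {t : GroundTerm L}
    (ht : t ∈ U) : (@Term.realize L _ (termStructure U t₀ H) _ x t).down.1 = t := by
  induction t with
  | var i => exact i.elim0
  | func f ts ih =>
    have hts := fun i => ih i (hU _ ht _ (.func f ts i .refl))
    have he : Term.func f (fun i => (@Term.realize L _ (termStructure U t₀ H) _ x (ts i)).down.1) =
        Term.func f ts := congrArg _ (funext hts)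
    exact (congrArg Subtype.val (dif_pos (he ▸ ht))).trans he

/-- An open node has a model of what it concludes within `S`. The domain consists of the ground
terms that occur in the limit of a saturation, or of one constant if there are none. -/
theorem IsOpenNode.exists_model [Infinite L.Constants] (hΓ : IsOpenNode PredRule S Γ) :
    ∃ (M : Type max u v) (_ : Nonempty M) (s : L.Structure M),
      ∀ φ ∈ claimsWithin S Γ, SentHolds s φ := by
  obtain ⟨c₀⟩ : Nonempty L.Constants := inferInstance
  obtain ⟨G, rfl, hG, hG'⟩ := exists_chain (C := IsOpenNode PredRule S)
    (fun Γ h => (((forceable_expansions (fun _ _ => .prop) Sent.expansion_unique h.finite).and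
      (forceable_delta h.finite)).and
      ((forceable_gamma h.finite).and (forceable_gamma_constant h.finite c₀))).force
        Γ subset_rfl h) hΓ
  choose hopen hsat using hG'
  have hH := isHintikka_of_chain (fun _ _ => .prop) hG hopen fun n => (hsat n).1.1
  have hGsub : ∀ n, G n ⊆ ⋃ n, G n := Set.subset_iUnion G
  generalize hω : (⋃ n, G n) = Γω at hH hGsub
  have hocc : ∀ {t}, OccursIn t Γω → ∃ n, OccursIn t (G n) := by
    rintro t ⟨ψ, ⟨S', h⟩, ht⟩
    obtain ⟨n, hn⟩ := Set.mem_iUnion.1 (hω ▸ h)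
    exact ⟨n, ψ, ⟨S', hn⟩, ht⟩
  -- The two alternatives mirror `Usable`, so that universal claims are instantiated on all of `U`.
  let U : Set (GroundTerm L) :=
    {t | OccursIn t Γω ∨ (∀ t', ¬ OccursIn t' Γω) ∧ t = c₀.term}
  have hU : ∀ t ∈ U, ∀ s, IsSubterm s t → s ∈ U := by
    rintro t (ht | ⟨hno, rfl⟩) s hs
    · exact .inl (ht.of_isSubterm hs)
    · refine .inr ⟨hno, ?_⟩
      cases hs with
      | refl => rfl
      | func _ _ i => exact i.elim0
  have hUne : U.Nonempty := by
    by_cases h : ∃ t, OccursIn t Γω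
    · obtain ⟨t, ht⟩ := h
      exact ⟨t, .inl ht⟩
    · exact ⟨_, .inr ⟨not_exists.1 h, rfl⟩⟩
  obtain ⟨t₀, ht₀⟩ := hUne
  refine ⟨ULift.{v} U, ⟨⟨t₀, ht₀⟩⟩, termStructure U ⟨t₀, ht₀⟩ (claimsWithin S Γω), ?_⟩
  let _ := termStructure U ⟨t₀, ht₀⟩ (claimsWithin S Γω)
  rintro φ ⟨S₁, hS₁, h₁⟩
  refine (hH.agrees_sent (termStructure U ⟨t₀, ht₀⟩ (claimsWithin S Γω)) (fun a => a.down.1)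
    ?_ ?_ ?_ ?_ ?_ φ).1 ⟨S₁, hS₁, hGsub 0 h₁⟩
  · exact fun a => ULift.down_injective (Subtype.ext (realize_termStructure hU _ a.down.2))
  · rintro φ ⟨S', -, h⟩ t ht
    exact realize_termStructure hU _ (.inl ⟨_, ⟨S', h⟩, ht⟩)
  · exact fun Q x => Iff.rfl
  · rintro χ f hf ⟨S', hS', h⟩ ⟨t, ht⟩
    refine ⟨S', hS', ?_⟩
    obtain ⟨m, hm⟩ := Set.mem_iUnion.1 (hω ▸ h)
    obtain ht | ⟨hno, rfl⟩ := ht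
    · -- Both the claim and the term are present from stage `max m n` on.
      obtain ⟨n, hn⟩ := hocc ht
      exact hGsub _ ((hsat (max m n)).2.1 _ (hG (le_max_left m n) hm) t
        (hn.mono (hG (le_max_right m n))) χ f rfl hf)
    · obtain ⟨t', ht'⟩ | h' := (hsat m).2.2 _ hm χ f rfl hf
      · exact absurd (ht'.mono (hGsub _)) (hno t')
      · exact hGsub _ h'
  · rintro χ f hf ⟨S', hS', h⟩
    obtain ⟨m, hm⟩ := Set.mem_iUnion.1 (hω ▸ h)
    obtain ⟨c, hc⟩ := (hsat m).1.2 _ hm χ f rfl hf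
    exact ⟨c.term, S', hS', hGsub _ hc⟩

theorem closable_of_predInconsistent [Infinite L.Constants] (hΓ : Γ.Finite)
    (hS : ∀ s ∈ S, ({s}, s.hat) ∈ Γ) (hinc : PredInconsistent (hatSet S)) :
    Closable PredRule S Γ := by
  by_contra hcl
  obtain ⟨M, hM, s, hs⟩ := IsOpenNode.exists_model ⟨hΓ, hcl⟩
  refine hinc ⟨M, hM, s, fun φ hφ => hs φ ?_⟩
  obtain ⟨e, he, h⟩ := hφ
  exact ⟨{e}, Set.singleton_subset_iff.2 he, h ▸ hS e he⟩

end

end ArgTab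

open ArgTab
theorem mainTheorem6 :
    -- propositional logic
    (∀ (P : Type u) (d : ℕ) (Γ₀ : Node (PForm P) (SuppLevel (PForm P) d)),
      Γ₀.Finite → (∀ a ∈ Γ₀, IsRootArgument a) →
      ∀ T : Tableau PropRule Γ₀,
        (∀ S, T.IsClosureSupport S →
          hatSet S ⊆ conclusions Γ₀ ∧ PropInconsistent (hatSet S)) ∧
        (∀ S ⊆ elements Γ₀, Set.InjOn SuppElem.hat S →
          hatSet S ⊆ conclusions Γ₀ → Minimal PropInconsistent (hatSet S) →
          ∃ T' : Tableau PropRule Γ₀, T.Extends T' ∧ T'.IsClosureSupport S)) ∧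
    -- predicate logic
    (∀ (L : FirstOrder.Language.{u, v}) [Infinite L.Constants] (d : ℕ)
      (Γ₀ : Node (Sent L) (SuppLevel (Sent L) d)),
      Γ₀.Finite → (∀ a ∈ Γ₀, IsRootArgument a) →
      ∀ T : Tableau PredRule Γ₀,
        (∀ S, T.IsClosureSupport S →
          hatSet S ⊆ conclusions Γ₀ ∧ PredInconsistent (hatSet S)) ∧
        (∀ S ⊆ elements Γ₀, Set.InjOn SuppElem.hat S →
          hatSet S ⊆ conclusions Γ₀ → Minimal PredInconsistent (hatSet S) →
          ∃ T' : Tableau PredRule Γ₀, T.Extends T' ∧ T'.IsClosureSupport S)) := by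
  refine ⟨fun P d Γ₀ hΓ₀ hroot T => ?_, fun L _ d Γ₀ hΓ₀ hroot T => ?_⟩
  · exact closureSupport_characterization (fun _ _ h => h.finite)
      (fun _ _ h => h.elements_subset)
      (fun _ _ _ hΓ h => propInconsistent_of_isClosureSupport hΓ h)
      (fun _ _ => closable_of_propInconsistent) Γ₀ hΓ₀ hroot T
  · exact closureSupport_characterization (fun _ _ h => h.finite)
      (fun _ _ h => h.elements_subset)
      (fun _ _ _ hΓ h => predInconsistent_of_isClosureSupport hΓ h)
      (fun _ _ => closable_of_predInconsistent) Γ₀ hΓ₀ hroot T
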